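/- Let $P$ be a simple polygon in the plane with $n$ vertices (straight angles at vertices are allowed), regarded as a closed region. In a closed region $E$, fix maximum speeds $\bar v_I,\bar v_G\ge 0$ of an intruder and of the guards. Two points of $E$ are mutually visible if the segment joining them lies in $E$. We say that $k$ mobile guards can track the intruder in $E$ if they have a strategy which, for every motion of the intruder in $E$ during $[0,\infty)$ with speed at most $\bar v_I$, moves $k$ guards within $E$ with speed at most $\bar v_G$, such that the guards' positions up to time $t$ (including their initial positions) depend only on the intruder's motion up to time $t$, and such that at every time the intruder is visible to at least one guard. Let $T$ be a triangulation of $P$ by diagonals, and consider a minimal partitioning of $P$ by diagonals of $T$, that is, a partition of $P$, obtained by cutting along some of the diagonals of $T$, into polygons $P_1,\dots,P_r$ where $P_i$ has $n_i\in\{6,7,8,9\}$ edges, and possibly one further polygon $P'$ with $3$, $4$ or $5$ edges. (Edges are counted between consecutive vertices of $P$ on the boundary of the piece.) Suppose that 1. $r\ge 3$ (the leftover piece $P'$ is not counted), and 2. for every $i\in\{1,\dots,r\}$, some number of mobile guards less than $\lfloor n_i/3\rfloor$ can track the intruder in $P_i$ (nothing is assumed about $P'$). Then some number of mobile guards less than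 $\lfloor n/3\rfloor$ can track the intruder in $P$ (with the same speeds $\bar v_I$, $\bar v_G$). -/

import Mathlib

open scoped NNReal

/-- The Euclidean plane. -/
abbrev Plane : Type := EuclideanSpace ℝ (Fin 2)

/-- A simple polygon, given by the cyclic sequence of its `n ≥ 3` distinct vertices. The edges are
the segments joining consecutive vertices; two consecutive edges meet only in their common vertex
and two non-consecutive edges are disjoint. Straight angles are allowed at vertices. -/
structure SimplePolygon where
  /-- The number of vertices, which is also the number of edges. -/
  n : ℕ
  three_le : 3 ≤ n
  /-- The vertices in cyclic order. -/
  vertex : ZMod n → Plane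
  vertex_injective : Function.Injective vertex
  consecutive : ∀ i : ZMod n,
    segment ℝ (vertex i) (vertex (i + 1)) ∩ segment ℝ (vertex (i + 1)) (vertex (i + 2)) =
      {vertex (i + 1)}
  nonconsecutive : ∀ i j : ZMod n, i ≠ j → i + 1 ≠ j → j + 1 ≠ i →
    Disjoint (segment ℝ (vertex i) (vertex (i + 1))) (segment ℝ (vertex j) (vertex (j + 1)))

namespace SimplePolygon

/-- The boundary curve of the polygon: the union of its edges. -/
def boundary (P : SimplePolygon) : Set Plane :=
  ⋃ i : ZMod P.n, segment ℝ (P.vertex i) (P.vertex (i + 1))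

/-- The closed region bounded by the polygon: the boundary curve, together with the points of its
complement that lie in a bounded connected component of the complement. -/
def region (P : SimplePolygon) : Set Plane :=
  {x | x ∈ P.boundary ∨ Bornology.IsBounded (connectedComponentIn P.boundaryᶜ x)}

/-- The segment joining the vertices with indices `a` and `a + m` is a diagonal of `P`: it joins two
non-adjacent vertices, and apart from its end points it runs in the interior of `P`. -/
def IsDiagonal (P : SimplePolygon) (a : ZMod P.n) (m : ℕ) : Prop :=
  2 ≤ m ∧ m + 2 ≤ P.n ∧
    openSegment ℝ (P.vertex a) (P.vertex (a + m)) ⊆ interior P.region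

/-- The diagonal of `P` from vertex `a` to vertex `a + m` partitions `P` into `Q` and `R`.
The polygon `Q` has the vertices `a, a + 1, …, a + m` of `P`, and `R` has the vertices
`a + m, a + m + 1, …, a + n = a`; the two regions make up that of `P`, and they have
precisely the diagonal in common. -/
structure IsCut (P : SimplePolygon) (a : ZMod P.n) (m : ℕ) (Q R : SimplePolygon) : Prop where
  isDiagonal : P.IsDiagonal a m
  left_n : Q.n = m + 1
  left_vertex : ∀ t : ℕ, t ≤ m → Q.vertex (t : ZMod Q.n) = P.vertex (a + t)
  right_n : R.n = P.n - m + 1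
  right_vertex : ∀ t : ℕ, t ≤ P.n - m → R.vertex (t : ZMod R.n) = P.vertex (a + m + t)
  union_region : Q.region ∪ R.region = P.region
  inter_region : Q.region ∩ R.region = segment ℝ (P.vertex a) (P.vertex (a + m))

/-- `T` is (the set of diagonals of) a triangulation of `P`: cutting along the diagonals in `T`,
one after the other, leaves only triangles. A diagonal is recorded by its pair of end points. -/
inductive IsTriangulation : SimplePolygon → Set (Sym2 Plane) → Prop
  | triangle (P : SimplePolygon) (h : P.n = 3) : IsTriangulation P ∅
  | cut (P Q R : SimplePolygon) (a : ZMod P.n) (m : ℕ) (T₁ T₂ : Set (Sym2 Plane))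
      (h : P.IsCut a m Q R) (h₁ : IsTriangulation Q T₁) (h₂ : IsTriangulation R T₂) :
      IsTriangulation P (insert s(P.vertex a, P.vertex (a + m)) (T₁ ∪ T₂))

/-- `IsPartition P T S`: some of the diagonals of the triangulation `T` of `P` partition `P` into
the polygons in `S`. One cuts `P` along these diagonals, one after the other; the remaining
diagonals of `T` triangulate the pieces. -/
inductive IsPartition : SimplePolygon → Set (Sym2 Plane) → Multiset SimplePolygon → Prop
  | piece (P : SimplePolygon) (T : Set (Sym2 Plane)) (h : IsTriangulation P T) :
      IsPartition P T {P}
  | cut (P Q R : SimplePolygon) (a : ZMod P.n) (m : ℕ) (T₁ T₂ : Set (Sym2 Plane))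
      (S₁ S₂ : Multiset SimplePolygon)
      (h : P.IsCut a m Q R) (h₁ : IsPartition Q T₁ S₁) (h₂ : IsPartition R T₂ S₂) :
      IsPartition P (insert s(P.vertex a, P.vertex (a + m)) (T₁ ∪ T₂)) (S₁ + S₂)

/-- The set `T` in a partition by diagonals of `T` is a triangulation of the whole polygon. -/
theorem IsPartition.isTriangulation {P : SimplePolygon} {T : Set (Sym2 Plane)}
    {S : Multiset SimplePolygon} (h : IsPartition P T S) : IsTriangulation P T := by
  induction h with
  | piece P T h => exact h
  | cut P Q R a m T₁ T₂ S₁ S₂ h _ _ ih₁ ih₂ => exact .cut P Q R a m T₁ T₂ h ih₁ ih₂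

/-- A minimal partitioning of `P` by diagonals of the triangulation `T`: all pieces have
6, 7, 8 or 9 edges, except for at most one, which has 3, 4 or 5. -/
structure IsMinimalPartition (P : SimplePolygon) (T : Set (Sym2 Plane))
    (S : Multiset SimplePolygon) : Prop where
  isPartition : IsPartition P T S
  le_nine : ∀ Q ∈ S, Q.n ≤ 9
  leftover : S.countP (fun Q => Q.n < 6) ≤ 1

end SimplePolygon

/-- Two points of the environment `E` see each other if their line of sight lies in `E`. -/
def Visible (E : Set Plane) (p q : Plane) : Prop :=
  segment ℝ p q ⊆ E

/-- A motion in the environment `E` over the time interval `[0, ∞)`, with speed at most `v`. -/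
def IsMotion (E : Set Plane) (v : ℝ≥0) (x : ℝ≥0 → Plane) : Prop :=
  LipschitzWith v x ∧ ∀ t, x t ∈ E

/-- In the environment `E`, a team of `k` guards of maximum speed `vG` can track an intruder of
maximum speed `vI`: the guards have a joint strategy `σ`, which assigns to the intruder's
motion `x` a motion `σ x i` of each guard `i`, such that the positions of the guards up to time
`t` depend only on the motion of the intruder up to time `t`, and such that at all times the
intruder is visible to at least one guard. -/
def CanTrack (E : Set Plane) (vI vG : ℝ≥0) (k : ℕ) : Prop :=
  ∃ σ : (ℝ≥0 → Plane) → Fin k → ℝ≥0 → Plane,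
    (∀ x, IsMotion E vI x → ∀ i, IsMotion E vG (σ x i)) ∧
    (∀ x y, IsMotion E vI x → IsMotion E vI y → ∀ t, (∀ s ≤ t, x s = y s) →
      ∀ i, ∀ s ≤ t, σ x i s = σ y i s) ∧
    (∀ x, IsMotion E vI x → ∀ t, ∃ i, Visible E (σ x i t) (x t))

/-! ### Transferring motions to the two sides of a cut -/

/-! The pieces can be guarded independently. Across a cut, the team of each side follows the image
of the intruder under a retraction that collapses the other side onto the diagonal; this image is a
legal motion in its piece and equals the intruder whenever the intruder is there, so numbers of
guards add up (`CanTrack.union`, `IsPartition.canTrack`). A leftover piece with at most 5 edges is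
star-shaped from a vertex, so one fixed guard suffices (`IsTriangulation.exists_seesAll`).

It remains to count. The quantity `n - 2` is additive under cuts. A large piece uses `k ≤ ⌊n/3⌋ - 1`
guards, and `3k + 1 ≤ n - 2` for `n = 6, …, 9`; the leftover exceeds its share `n - 2` by at most 2.
In total `3k + r ≤ (n - 2) + 2 = n`, and `r ≥ 3` gives `k < ⌊n/3⌋`. -/

theorem exists_retraction_segment {E : Type*} [NormedAddCommGroup E] [InnerProductSpace ℝ E]
    (a b : E) :
    ∃ p : E → E, LipschitzWith 1 p ∧ (∀ x, p x ∈ segment ℝ a b) ∧ ∀ x ∈ segment ℝ a b, p x = x := by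
  rcases eq_or_ne a b with rfl | hab
  · refine ⟨fun _ => a, LipschitzWith.const' a, by simp, fun x hx => ?_⟩
    rw [segment_same] at hx
    exact hx.symm
  have hpos : 0 < ‖b - a‖ := norm_pos_iff.2 (sub_ne_zero.2 hab.symm)
  -- `c x` is the coordinate of the orthogonal projection of `x` to the line through `a` and `b`;
  -- `t` clamps it to the segment.
  let c : E → ℝ := fun x => inner ℝ (b - a) (x - a) / ‖b - a‖ ^ 2
  let t : E → ℝ := fun x => (Set.projIcc (0 : ℝ) 1 zero_le_one (c x) : ℝ)
  have hc : ∀ x y, |c x - c y| * ‖b - a‖ ≤ dist x y := by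
    intro x y
    have h1 : c x - c y = inner ℝ (b - a) (x - y) / ‖b - a‖ ^ 2 := by
      simp only [c]
      rw [← sub_div, ← inner_sub_right]
      congr 2
      abel
    rw [h1, abs_div, abs_of_pos (pow_pos hpos 2), dist_eq_norm, div_mul_eq_mul_div,
      div_le_iff₀ (pow_pos hpos 2)]
    nlinarith [abs_real_inner_le_norm (b - a) (x - y)]
  have ht : ∀ x y, |t x - t y| ≤ |c x - c y| := by
    intro x y
    have := (LipschitzWith.projIcc (zero_le_one (α := ℝ))).dist_le_mul (c x) (c y)
    simpa [Subtype.dist_eq, Real.dist_eq] using this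
  refine ⟨fun x => AffineMap.lineMap a b (t x), LipschitzWith.mk_one fun x y => ?_, fun x => ?_, ?_⟩
  · rw [dist_lineMap_lineMap, Real.dist_eq, dist_comm a b, dist_eq_norm b a]
    exact (mul_le_mul_of_nonneg_right (ht x y) hpos.le).trans (hc x y)
  · rw [segment_eq_image_lineMap]
    exact ⟨t x, (Set.projIcc (0 : ℝ) 1 zero_le_one (c x)).2, rfl⟩
  · intro x hx
    rw [segment_eq_image_lineMap] at hx
    obtain ⟨s, hs, rfl⟩ := hx
    have h1 : c (AffineMap.lineMap a b s) = s := by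
      simp only [c, AffineMap.lineMap_apply, vsub_eq_sub, vadd_eq_add, add_sub_cancel_right,
        inner_smul_right, real_inner_self_eq_norm_sq]
      field_simp
    simp only [t, h1, Set.projIcc_of_mem zero_le_one hs]

/-- A path in the union of two closed sets stays Lipschitz when its part in one of them is
pushed onto their intersection by a nonexpansive retraction. -/
theorem IsMotion.retract {Q R D : Set Plane} (hQ : IsClosed Q) (hR : IsClosed R)
    (hD : Q ∩ R = D) {p : Plane → Plane} (hp : LipschitzWith 1 p) (hpD : ∀ x, p x ∈ D)
    {f : Plane → Plane} (hfQ : ∀ x ∈ Q, f x = x)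
    (hfR : ∀ x ∈ R, f x = p x) {v : ℝ≥0} {x : ℝ≥0 → Plane} (hx : IsMotion (Q ∪ R) v x) :
    IsMotion Q v (f ∘ x) := by
  obtain ⟨hlip, hmem⟩ := hx
  have key : ∀ s t, s ≤ t → dist (f (x s)) (f (x t)) ≤ v * dist s t := by
    intro s t hst
    have hQQ : ∀ s t, x s ∈ Q → x t ∈ Q → dist (f (x s)) (f (x t)) ≤ v * dist s t := by
      intro s t hs ht
      rw [hfQ _ hs, hfQ _ ht]
      exact hlip.dist_le_mul s t
    have hRR : ∀ s t, x s ∈ R → x t ∈ R → dist (f (x s)) (f (x t)) ≤ v * dist s t := by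
      intro s t hs ht
      rw [hfR _ hs, hfR _ ht]
      exact ((hp.dist_le_mul _ _).trans_eq (one_mul _)).trans (hlip.dist_le_mul s t)
    have mixed : (x s ∈ Q ∧ x t ∈ R ∨ x s ∈ R ∧ x t ∈ Q) →
        dist (f (x s)) (f (x t)) ≤ v * dist s t := by
      intro hmix
      -- By connectedness of `[s, t]` the path meets `Q ∩ R` at some time `u`, where both one-sided
      -- estimates apply; they add up without loss because `u` lies between `s` and `t`.
      have hpre := isPreconnected_closed_iff.1 (isPreconnected_Icc (a := s) (b := t))
        (x ⁻¹' Q) (x ⁻¹' R) (hQ.preimage hlip.continuous) (hR.preimage hlip.continuous)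
        (fun u _ => hmem u)
      have hs' : s ∈ Set.Icc s t := ⟨le_rfl, hst⟩
      have ht' : t ∈ Set.Icc s t := ⟨hst, le_rfl⟩
      have hex : ∃ u ∈ Set.Icc s t, x u ∈ Q ∧ x u ∈ R := by
        rcases hmix with ⟨h1, h2⟩ | ⟨h1, h2⟩
        · exact hpre ⟨s, hs', h1⟩ ⟨t, ht', h2⟩
        · exact hpre ⟨t, ht', h2⟩ ⟨s, hs', h1⟩
      obtain ⟨u, ⟨hsu, hut⟩, huQ, huR⟩ := hex
      have hd : dist s u + dist u t = dist s t := by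
        have h1 : (s : ℝ) ≤ u := hsu
        have h2 : (u : ℝ) ≤ t := hut
        simp only [NNReal.dist_eq]
        rw [abs_of_nonpos (by linarith), abs_of_nonpos (by linarith), abs_of_nonpos (by linarith)]
        ring
      rw [← hd, mul_add]
      refine (dist_triangle _ (f (x u)) _).trans (add_le_add ?_ ?_)
      · rcases hmix with ⟨h1, _⟩ | ⟨h1, _⟩
        · exact hQQ s u h1 huQ
        · exact hRR s u h1 huR
      · rcases hmix with ⟨_, h2⟩ | ⟨_, h2⟩
        · exact hRR u t huR h2
        · exact hQQ u t huQ h2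
    rcases hmem s with hs | hs <;> rcases hmem t with ht | ht
    · exact hQQ s t hs ht
    · exact mixed (.inl ⟨hs, ht⟩)
    · exact mixed (.inr ⟨hs, ht⟩)
    · exact hRR s t hs ht
  refine ⟨LipschitzWith.of_dist_le_mul fun s t => ?_, fun t => ?_⟩
  · rcases le_total s t with h | h
    · exact key s t h
    · rw [dist_comm, dist_comm s t]
      exact key t s h
  · rcases hmem t with h | h
    · simpa [hfQ _ h] using h
    · have : p (x t) ∈ Q ∩ R := hD ▸ hpD (x t)
      simpa [hfR _ h] using this.1

/-- `f` need not be nonexpansive on `Q ∪ R` for the Euclidean distance; only along motions is the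
speed bound kept. As `f` acts pointwise in time, following `f ∘ x` uses no knowledge of the future.
-/
theorem exists_motion_retraction {Q R : Set Plane} {a b : Plane} (hQ : IsClosed Q)
    (hR : IsClosed R) (hD : Q ∩ R = segment ℝ a b) :
    ∃ f : Plane → Plane, (∀ x ∈ Q, f x = x) ∧
      ∀ (v : ℝ≥0) (x : ℝ≥0 → Plane), IsMotion (Q ∪ R) v x → IsMotion Q v (f ∘ x) := by
  classical
  obtain ⟨p, hp, hpD, hpid⟩ := exists_retraction_segment a b
  have hfQ : ∀ x ∈ Q, (fun x => if x ∈ Q then x else p x) x = x := fun x hx => if_pos hx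
  refine ⟨fun x => if x ∈ Q then x else p x, hfQ, fun v x hx =>
    IsMotion.retract hQ hR hD hp hpD hfQ (fun y hy => ?_) hx⟩
  by_cases h : y ∈ Q
  · simp only [h, if_true]
    exact (hpid y (hD ▸ ⟨h, hy⟩)).symm
  · simp only [h, if_false]

theorem Visible.mono {E F : Set Plane} (h : E ⊆ F) {p q : Plane} (hv : Visible E p q) :
    Visible F p q :=
  Set.Subset.trans hv h

theorem IsMotion.mono {E F : Set Plane} (h : E ⊆ F) {v : ℝ≥0} {x : ℝ≥0 → Plane}
    (hx : IsMotion E v x) : IsMotion F v x :=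
  ⟨hx.1, fun t => h (hx.2 t)⟩

/-- Guards who track the intruder on either side of a line of sight track it on both sides:
the guards on each side follow the image of the intruder under a retraction onto their side. -/
theorem CanTrack.union {Q R : Set Plane} {a b : Plane} (hQ : IsClosed Q) (hR : IsClosed R)
    (hD : Q ∩ R = segment ℝ a b) {vI vG : ℝ≥0} {k l : ℕ} (hk : CanTrack Q vI vG k)
    (hl : CanTrack R vI vG l) : CanTrack (Q ∪ R) vI vG (k + l) := by
  obtain ⟨f, hfid, hf⟩ := exists_motion_retraction hQ hR hD
  obtain ⟨g, hgid, hg⟩ := exists_motion_retraction hR hQ (Set.inter_comm R Q ▸ hD)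
  simp only [Set.union_comm R Q] at hg
  obtain ⟨σ, hσ, hσc, hσv⟩ := hk
  obtain ⟨τ, hτ, hτc, hτv⟩ := hl
  refine ⟨fun x => Fin.append (σ (f ∘ x)) (τ (g ∘ x)), ?_, ?_, ?_⟩
  · intro x hx i
    refine Fin.addCases (fun i => ?_) (fun i => ?_) i
    · simp only [Fin.append_left]
      exact (hσ _ (hf _ _ hx) i).mono Set.subset_union_left
    · simp only [Fin.append_right]
      exact (hτ _ (hg _ _ hx) i).mono Set.subset_union_right
  · intro x y hx hy t hxy i s hs
    refine Fin.addCases (fun i => ?_) (fun i => ?_) i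
    · simp only [Fin.append_left]
      exact hσc _ _ (hf _ _ hx) (hf _ _ hy) t (fun r hr => congrArg f (hxy r hr)) i s hs
    · simp only [Fin.append_right]
      exact hτc _ _ (hg _ _ hx) (hg _ _ hy) t (fun r hr => congrArg g (hxy r hr)) i s hs
  · intro x hx t
    rcases hx.2 t with h | h
    · obtain ⟨i, hi⟩ := hσv _ (hf _ _ hx) t
      refine ⟨Fin.castAdd l i, ?_⟩
      simp only [Fin.append_left]
      rw [Function.comp_apply, hfid _ h] at hi
      exact hi.mono Set.subset_union_left
    · obtain ⟨i, hi⟩ := hτv _ (hg _ _ hx) t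
      refine ⟨Fin.natAdd k i, ?_⟩
      simp only [Fin.append_right]
      rw [Function.comp_apply, hgid _ h] at hi
      exact hi.mono Set.subset_union_right

/-- A guard standing at a point which sees everything tracks the intruder. -/
theorem CanTrack.one_of_visible {E : Set Plane} {p : Plane} (hp : p ∈ E)
    (h : ∀ x ∈ E, Visible E p x) (vI vG : ℝ≥0) : CanTrack E vI vG 1 :=
  ⟨fun _ _ _ => p, fun _ _ _ => ⟨LipschitzWith.const' p, fun _ => hp⟩,
    fun _ _ _ _ _ _ _ _ _ => rfl, fun _ hx t => ⟨0, h _ (hx.2 t)⟩⟩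

/-! ### Regions of polygons -/

namespace SimplePolygon

theorem isCompact_boundary (P : SimplePolygon) : IsCompact P.boundary := by
  have : NeZero P.n := ⟨by have := P.three_le; omega⟩
  refine isCompact_iUnion fun i => ?_
  rw [segment_eq_image_lineMap]
  exact isCompact_Icc.image AffineMap.lineMap_continuous

theorem isClosed_region (P : SimplePolygon) : IsClosed P.region := by
  rw [← isOpen_compl_iff, isOpen_iff_forall_mem_open]
  intro x hx
  have hx' : x ∉ P.boundary ∧ ¬ Bornology.IsBounded (connectedComponentIn P.boundaryᶜ x) :=
    not_or.1 hx
  refine ⟨connectedComponentIn P.boundaryᶜ x, fun y hy => ?_,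
    P.isCompact_boundary.isClosed.isOpen_compl.connectedComponentIn,
    mem_connectedComponentIn hx'.1⟩
  refine not_or.2 ⟨connectedComponentIn_subset _ _ hy, ?_⟩
  rw [← connectedComponentIn_eq hy]
  exact hx'.2

theorem vertex_mem_region (P : SimplePolygon) (i : ZMod P.n) : P.vertex i ∈ P.region :=
  .inl (Set.mem_iUnion.2 ⟨i, left_mem_segment ℝ _ _⟩)

/-- A point outside `C` escapes to infinity along a ray on which a separating functional increases.
The component of a point of `C` off the boundary cannot cross `frontier C`, so it stays in `interior
C`. -/
theorem region_eq_of_frontier_subset (P : SimplePolygon) {C : Set Plane} (hC : Convex ℝ C)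
    (hcl : IsClosed C) (hb : Bornology.IsBounded C) (hfr : frontier C ⊆ P.boundary)
    (hsub : P.boundary ⊆ C) : P.region = C := by
  ext x
  constructor
  · rintro (hx | hx)
    · exact hsub hx
    by_contra hxC
    obtain ⟨f, u, hu, hfx⟩ := geometric_hahn_banach_closed_point hC hcl hxC
    -- a ray on which `f` increases avoids `C`
    have hne : f ≠ 0 := by
      rintro rfl
      have hv : P.vertex 0 ∈ C := hsub (Set.mem_iUnion.2 ⟨0, left_mem_segment ℝ _ _⟩)
      have := hu _ hv
      simp only [zero_apply] at this hfx
      linarith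
    obtain ⟨w, hw⟩ : ∃ w, 0 < f w := by
      obtain ⟨w, hw⟩ : ∃ w, f w ≠ 0 := by
        by_contra! h
        exact hne (ContinuousLinearMap.ext h)
      rcases hw.lt_or_gt with h | h
      · exact ⟨-w, by simpa using h⟩
      · exact ⟨w, h⟩
    let ray : Set Plane := (fun t : ℝ => x + t • w) '' Set.Ici 0
    have hray : IsPreconnected ray :=
      isPreconnected_Ici.image _ (by fun_prop)
    have hfray : ∀ t : ℝ, f (x + t • w) = f x + t * f w := by
      intro t
      simp
    have hrsub : ray ⊆ P.boundaryᶜ := by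
      rintro _ ⟨t, ht, rfl⟩ hmem
      have h1 := hu _ (hsub hmem)
      simp only [hfray] at h1
      have : 0 ≤ t * f w := mul_nonneg ht hw.le
      linarith
    have hrb : Bornology.IsBounded ray :=
      hx.subset (hray.subset_connectedComponentIn ⟨0, by simp, by simp⟩ hrsub)
    have hfb : Bornology.IsBounded (f '' ray) := f.lipschitz.isBounded_image hrb
    obtain ⟨M, hM⟩ := hfb.bddAbove
    -- At this parameter `f` takes the value `f x + |M - f x| + 1 > M` on the ray.
    have ht : 0 ≤ (|M - f x| + 1) / f w := by positivity
    have h2 := hM ⟨_, ⟨_, ht, rfl⟩, rfl⟩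
    simp only [hfray] at h2
    rw [div_mul_cancel₀ _ hw.ne'] at h2
    linarith [le_abs_self (M - f x)]
  · intro hx
    by_cases hxb : x ∈ P.boundary
    · exact .inl hxb
    refine .inr (hb.subset ?_)
    have hint : ∀ y ∈ C, y ∉ P.boundary → y ∈ interior C := by
      intro y hy hyb
      by_contra h
      exact hyb (hfr ⟨subset_closure hy, h⟩)
    refine (IsPreconnected.subset_left_of_subset_union isOpen_interior hcl.isOpen_compl
      (disjoint_compl_right.mono_left interior_subset) ?_
      ⟨x, mem_connectedComponentIn hxb, hint x hx hxb⟩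
      isPreconnected_connectedComponentIn).trans interior_subset
    intro y hy
    by_cases hyC : y ∈ C
    · exact .inl (hint y hyC (connectedComponentIn_subset _ _ hy))
    · exact .inr hyC

end SimplePolygon

/-- The interior is where all barycentric coordinates are positive, so on the frontier one of them
vanishes. -/
theorem frontier_convexHull_triangle_subset {A B C : Plane}
    (h : AffineIndependent ℝ ![A, B, C]) :
    frontier (convexHull ℝ {A, B, C}) ⊆ segment ℝ A B ∪ segment ℝ B C ∪ segment ℝ C A := by
  have htop : affineSpan ℝ (Set.range ![A, B, C]) = ⊤ :=
    h.affineSpan_eq_top_iff_card_eq_finrank_add_one.2 (by simp)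
  let b : AffineBasis (Fin 3) ℝ Plane := ⟨![A, B, C], h, htop⟩
  have hrange : Set.range b = {A, B, C} := by
    change Set.range ![A, B, C] = _
    ext y
    simp only [Matrix.range_cons, Matrix.range_empty, Set.mem_union, Set.mem_singleton_iff,
      Set.mem_insert_iff, Set.mem_empty_iff_false, or_false]
  have hclosed : IsClosed (convexHull ℝ ({A, B, C} : Set Plane)) :=
    (Set.toFinite _).isClosed_convexHull ℝ
  intro x hx
  rw [hclosed.frontier_eq, ← hrange, b.interior_convexHull, b.convexHull_eq_nonneg_coord] at hx
  obtain ⟨h0, h1⟩ := hx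
  simp only [Set.mem_ofPred_eq] at h0 h1
  have hsum := b.sum_coord_apply_eq_one x
  have hcomb := b.linear_combination_coord_eq_self x
  rw [Fin.sum_univ_three] at hsum hcomb
  change b.coord 0 x • A + b.coord 1 x • B + b.coord 2 x • C = x at hcomb
  push Not at h1
  obtain ⟨i, hi⟩ := h1
  have hi0 := le_antisymm hi (h0 i)
  fin_cases i
  · left; right
    replace hi0 : b.coord 0 x = 0 := hi0
    simp only [hi0, zero_add, zero_smul] at hsum hcomb
    exact ⟨_, _, h0 1, h0 2, hsum, hcomb⟩
  · right
    replace hi0 : b.coord 1 x = 0 := hi0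
    simp only [hi0, add_zero, zero_smul] at hsum hcomb
    exact ⟨_, _, h0 2, h0 0, by linarith, by rw [add_comm]; exact hcomb⟩
  · left; left
    replace hi0 : b.coord 2 x = 0 := hi0
    simp only [hi0, add_zero, zero_smul] at hsum hcomb
    exact ⟨_, _, h0 0, h0 1, hsum, hcomb⟩

namespace SimplePolygon

theorem convex_region_of_triangle (P : SimplePolygon) (hP : P.n = 3) : Convex ℝ P.region := by
  obtain ⟨A, B, C, hAB, hBC, hCA, hbd, h1, h2, h3⟩ : ∃ A B C : Plane, A ≠ B ∧ B ≠ C ∧ C ≠ A ∧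
      P.boundary = segment ℝ A B ∪ segment ℝ B C ∪ segment ℝ C A ∧
      segment ℝ A B ∩ segment ℝ B C = {B} ∧ segment ℝ B C ∩ segment ℝ C A = {C} ∧
      segment ℝ C A ∩ segment ℝ A B = {A} := by
    obtain ⟨n, hn, v, hinj, hcons, hnon⟩ := P
    change n = 3 at hP
    subst hP
    refine ⟨v 0, v 1, v 2, hinj.ne (by decide), hinj.ne (by decide), hinj.ne (by decide),
      ?_, hcons 0, hcons 1, hcons 2⟩
    ext x
    simp only [boundary, Set.mem_iUnion, Set.mem_union]
    constructor
    · rintro ⟨i, hi⟩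
      change Fin 3 at i
      fin_cases i
      · exact .inl (.inl hi)
      · exact .inl (.inr hi)
      · exact .inr hi
    · rintro ((h | h) | h)
      · exact ⟨0, h⟩
      · exact ⟨1, h⟩
      · exact ⟨2, h⟩
  have hind : AffineIndependent ℝ ![A, B, C] := by
    rw [affineIndependent_iff_not_collinear_set]
    intro hcol
    -- If the vertices were collinear, one would lie on the opposite edge, which then meets a
    -- consecutive edge in a second point.
    rcases hcol.wbtw_or_wbtw_or_wbtw with h | h | h
    · have : B ∈ segment ℝ C A ∩ segment ℝ A B :=
        ⟨by rw [segment_symm]; exact mem_segment_iff_wbtw.2 h, right_mem_segment ℝ _ _⟩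
      rw [h3] at this
      exact hAB this.symm
    · have : C ∈ segment ℝ A B ∩ segment ℝ B C :=
        ⟨by rw [segment_symm]; exact mem_segment_iff_wbtw.2 h, right_mem_segment ℝ _ _⟩
      rw [h1] at this
      exact hBC this.symm
    · have : A ∈ segment ℝ B C ∩ segment ℝ C A :=
        ⟨by rw [segment_symm]; exact mem_segment_iff_wbtw.2 h, right_mem_segment ℝ _ _⟩
      rw [h2] at this
      exact hCA this.symm
  have hconv := convex_convexHull ℝ ({A, B, C} : Set Plane)
  have hA : A ∈ convexHull ℝ ({A, B, C} : Set Plane) := subset_convexHull ℝ _ (by simp)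
  have hB : B ∈ convexHull ℝ ({A, B, C} : Set Plane) := subset_convexHull ℝ _ (by simp)
  have hC : C ∈ convexHull ℝ ({A, B, C} : Set Plane) := subset_convexHull ℝ _ (by simp)
  rw [P.region_eq_of_frontier_subset hconv ((Set.toFinite _).isClosed_convexHull ℝ)
    (isBounded_convexHull.2 (Set.toFinite _).isBounded)
    (hbd ▸ frontier_convexHull_triangle_subset hind)]
  · exact hconv
  · rw [hbd]
    exact Set.union_subset (Set.union_subset (hconv.segment_subset hA hB)
      (hconv.segment_subset hB hC)) (hconv.segment_subset hC hA)

/-! ### Polygons with at most five vertices -/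

/-- The vertex `i` of `P` sees the whole region of `P`. -/
def SeesAll (P : SimplePolygon) (i : ZMod P.n) : Prop :=
  ∀ x ∈ P.region, Visible P.region (P.vertex i) x

theorem seesAll_of_triangle (P : SimplePolygon) (hP : P.n = 3) (i : ZMod P.n) : P.SeesAll i :=
  fun _ hx => (P.convex_region_of_triangle hP).segment_subset (P.vertex_mem_region i) hx

theorem IsCut.seesAll {P Q R : SimplePolygon} {a : ZMod P.n} {m : ℕ} (h : P.IsCut a m Q R)
    {i : ZMod P.n} {j : ZMod Q.n} {k : ZMod R.n} (hj : Q.SeesAll j) (hk : R.SeesAll k)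
    (hij : Q.vertex j = P.vertex i) (hik : R.vertex k = P.vertex i) : P.SeesAll i := by
  intro x hx
  rw [← h.union_region] at hx ⊢
  rcases hx with hx | hx
  · rw [← hij]
    exact (hj x hx).mono Set.subset_union_left
  · rw [← hik]
    exact (hk x hx).mono Set.subset_union_right

section cutEnds

variable {P Q R : SimplePolygon} {a : ZMod P.n} {m : ℕ}

theorem IsCut.left_start (h : P.IsCut a m Q R) : Q.vertex ((0 : ℕ) : ZMod Q.n) = P.vertex a := by
  simpa using h.left_vertex 0 (Nat.zero_le _)

theorem IsCut.left_end (h : P.IsCut a m Q R) :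
    Q.vertex ((m : ℕ) : ZMod Q.n) = P.vertex (a + m) :=
  h.left_vertex m le_rfl

theorem IsCut.right_start (h : P.IsCut a m Q R) :
    R.vertex ((0 : ℕ) : ZMod R.n) = P.vertex (a + m) := by
  simpa using h.right_vertex 0 (Nat.zero_le _)

theorem IsCut.right_end (h : P.IsCut a m Q R) :
    R.vertex ((P.n - m : ℕ) : ZMod R.n) = P.vertex a := by
  rw [h.right_vertex _ le_rfl, add_assoc, ← Nat.cast_add,
    Nat.add_sub_cancel' (by have := h.isDiagonal.2.1; omega)]
  simp

end cutEnds

/-- Opposite vertices of a triangulated quadrilateral see everything; hence so does one of its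
vertices `0` and `3`. -/
theorem IsTriangulation.seesAll_of_quadrilateral {P : SimplePolygon} {T : Set (Sym2 Plane)}
    (h : IsTriangulation P T) (hP : P.n = 4) :
    P.SeesAll ((0 : ℕ) : ZMod P.n) ∨ P.SeesAll ((3 : ℕ) : ZMod P.n) := by
  cases h with
  | triangle _ h => omega
  | cut _ Q R a m T₁ T₂ h h₁ h₂ =>
    have hm : m = 2 := by have := h.isDiagonal.1; have := h.isDiagonal.2.1; omega
    subst hm
    have hQ : ∀ i, Q.SeesAll i := Q.seesAll_of_triangle h.left_n
    have hR : ∀ i, R.SeesAll i := R.seesAll_of_triangle (by rw [h.right_n, hP])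
    have ha : P.SeesAll a := h.seesAll (hQ _) (hR _) h.left_start h.right_end
    have hb : P.SeesAll (a + (2 : ℕ)) := h.seesAll (hQ _) (hR _) h.left_end h.right_start
    -- The diagonal joins either 0 and 2 or 1 and 3, so it always has 0 or 3 as an end.
    have hcases : ∀ n : ℕ, n = 4 → ∀ a : ZMod n, (a = ((0 : ℕ) : ZMod n) ∨ a = ((3 : ℕ) : ZMod n)) ∨
        (a + (2 : ℕ) = ((0 : ℕ) : ZMod n) ∨ a + (2 : ℕ) = ((3 : ℕ) : ZMod n)) := by
      rintro _ rfl
      decide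
    rcases hcases P.n hP a with (h0 | h0) | (h0 | h0)
    · exact .inl (h0 ▸ ha)
    · exact .inr (h0 ▸ ha)
    · exact .inl (h0 ▸ hb)
    · exact .inr (h0 ▸ hb)

/-- A pentagon is cut into a triangle and a quadrilateral, whose vertices 0 and 3 are the ends of
the cut. One of these sees the whole quadrilateral and, being also a vertex of the triangle, sees
that too. -/
theorem IsTriangulation.exists_seesAll {P : SimplePolygon} {T : Set (Sym2 Plane)}
    (h : IsTriangulation P T) (hP : P.n ≤ 5) : ∃ i, P.SeesAll i := by
  cases h with
  | triangle _ h => exact ⟨0, P.seesAll_of_triangle h 0⟩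
  | cut _ Q R a m T₁ T₂ h h₁ h₂ =>
    have hm2 := h.isDiagonal.1
    have hmn := h.isDiagonal.2.1
    have hQn := h.left_n
    have hRn := h.right_n
    by_cases hQ : Q.n = 3
    · have hQs : ∀ i, Q.SeesAll i := Q.seesAll_of_triangle hQ
      by_cases hR : R.n = 3
      · exact ⟨a, h.seesAll (hQs _) (R.seesAll_of_triangle hR _) h.left_start h.right_end⟩
      · have h3 : P.n - m = 3 := by omega
        rcases h₂.seesAll_of_quadrilateral (by omega) with hR | hR
        · exact ⟨_, h.seesAll (hQs _) hR h.left_end h.right_start⟩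
        · exact ⟨_, h.seesAll (hQs _) hR h.left_start (h3 ▸ h.right_end)⟩
    · have hm : m = 3 := by omega
      subst hm
      have hRs : ∀ i, R.SeesAll i := R.seesAll_of_triangle (by omega)
      rcases h₁.seesAll_of_quadrilateral hQn with hQ | hQ
      · exact ⟨_, h.seesAll hQ (hRs _) h.left_start h.right_end⟩
      · exact ⟨_, h.seesAll hQ (hRs _) h.left_end h.right_start⟩

/-! ### Counting guards -/

/-- A cut splits `n - 2` as `(m - 1) + (n - m - 1)`. -/
theorem IsPartition.sum_sub_two {P : SimplePolygon} {T : Set (Sym2 Plane)}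
    {S : Multiset SimplePolygon} (h : IsPartition P T S) :
    (S.map fun Q => Q.n - 2).sum + 2 = P.n := by
  induction h with
  | piece P T h =>
    have := P.three_le
    simp
    omega
  | cut P Q R a m T₁ T₂ S₁ S₂ h _ _ ih₁ ih₂ =>
    have := h.isDiagonal.2.1
    rw [h.left_n] at ih₁
    rw [h.right_n] at ih₂
    rw [Multiset.map_add, Multiset.sum_add]
    omega

theorem IsPartition.exists_isTriangulation {P : SimplePolygon} {T : Set (Sym2 Plane)}
    {S : Multiset SimplePolygon} (h : IsPartition P T S) :
    ∀ Q ∈ S, ∃ T', IsTriangulation Q T' := by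
  induction h with
  | piece P T h => simpa using ⟨T, h⟩
  | cut P Q R a m T₁ T₂ S₁ S₂ h _ _ ih₁ ih₂ =>
    intro Q' hQ'
    rcases Multiset.mem_add.1 hQ' with h | h
    · exact ih₁ _ h
    · exact ih₂ _ h

theorem IsPartition.canTrack {P : SimplePolygon} {T : Set (Sym2 Plane)}
    {S : Multiset SimplePolygon} (h : IsPartition P T S) {vI vG : ℝ≥0} {g : SimplePolygon → ℕ}
    (hg : ∀ Q ∈ S, ∃ k ≤ g Q, CanTrack Q.region vI vG k) :
    ∃ k ≤ (S.map g).sum, CanTrack P.region vI vG k := by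
  induction h with
  | piece P T h => simpa using hg
  | cut P Q R a m T₁ T₂ S₁ S₂ h _ _ ih₁ ih₂ =>
    obtain ⟨k, hk, hkt⟩ := ih₁ fun Q' hQ' => hg Q' (Multiset.mem_add.2 (.inl hQ'))
    obtain ⟨l, hl, hlt⟩ := ih₂ fun Q' hQ' => hg Q' (Multiset.mem_add.2 (.inr hQ'))
    refine ⟨k + l, by rw [Multiset.map_add, Multiset.sum_add]; exact add_le_add hk hl, ?_⟩
    rw [← h.union_region]
    exact hkt.union Q.isClosed_region R.isClosed_region h.inter_region hlt

/-- The number of guards used in a piece of a minimal partitioning. -/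
def guardBound (Q : SimplePolygon) : ℕ := if 6 ≤ Q.n then Q.n / 3 - 1 else 1

/-- Holds piece by piece: each large piece leaves a slack of 1, tight for 6 and 9 edges, and a small
one has a deficit of at most 2, tight for a triangle. -/
theorem three_mul_sum_guardBound_le (S : Multiset SimplePolygon) (h : ∀ Q ∈ S, Q.n ≤ 9) :
    3 * (S.map guardBound).sum + S.countP (fun Q => 6 ≤ Q.n) ≤
      (S.map fun Q => Q.n - 2).sum + 2 * S.countP (fun Q => Q.n < 6) := by
  induction S using Multiset.induction_on with
  | empty => simp
  | cons Q S ih =>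
    have ih := ih fun Q' hQ' => h Q' (Multiset.mem_cons_of_mem hQ')
    have h9 := h Q (Multiset.mem_cons_self Q S)
    have h3 := Q.three_le
    simp only [Multiset.map_cons, Multiset.sum_cons, Multiset.countP_cons, guardBound] at ih ⊢
    split_ifs <;> omega

end SimplePolygon

theorem mainTheorem1 (P : SimplePolygon) (T : Set (Sym2 Plane)) (S : Multiset SimplePolygon)
    (hS : P.IsMinimalPartition T S)
    (h3 : 3 ≤ S.countP (fun Q => 6 ≤ Q.n))
    (vI vG : ℝ≥0)
    (hpieces : ∀ Q ∈ S, 6 ≤ Q.n → ∃ k < Q.n / 3, CanTrack Q.region vI vG k) :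
    ∃ k < P.n / 3, CanTrack P.region vI vG k := by
  obtain ⟨k, hk, hkt⟩ := hS.isPartition.canTrack (vI := vI) (vG := vG)
    (g := SimplePolygon.guardBound) fun Q hQ => by
      unfold SimplePolygon.guardBound
      split_ifs with h6
      · obtain ⟨k, hk, hkt⟩ := hpieces Q hQ h6
        exact ⟨k, by omega, hkt⟩
      · obtain ⟨T', hT'⟩ := hS.isPartition.exists_isTriangulation Q hQ
        obtain ⟨i, hi⟩ := hT'.exists_seesAll (by omega)
        exact ⟨1, le_rfl, CanTrack.one_of_visible (Q.vertex_mem_region i) hi vI vG⟩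
  refine ⟨k, ?_, hkt⟩
  have h1 := SimplePolygon.three_mul_sum_guardBound_le S hS.le_nine
  have h2 := hS.isPartition.sum_sub_two
  have h4 := hS.leftover
  omega
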